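/- Let $F_n$ be the free group on a fixed basis $x_1,\dots,x_n$. For $i\neq j$ let $P_{ij}\in\mathrm{Aut}(F_n)$ be the automorphism sending $x_i$ to $x_jx_ix_j$ and fixing $x_l$ for all $l\neq i$, and let $\iota_i\in\mathrm{Aut}(F_n)$ be the automorphism sending $x_i$ to $x_i^{-1}$ and fixing $x_l$ for all $l\neq i$. Let $\mathrm{P\Pi A}_n$ be the subgroup of $\mathrm{Aut}(F_n)$ generated by all $P_{ij}$ ($i\ne j$) and all $\iota_i$ (the pure palindromic automorphism group), and for $0\le k\le n$ let $\mathrm{P\Pi A}_n(k)$ be the subgroup of those $\alpha\in \mathrm{P\Pi A}_n$ with $\alpha(x_i)=x_i$ for $1\le i\le k$. Let $\mathcal J_n(k)$ be the normal closure in $\mathrm{P\Pi A}_n(k)$ of the set $\{P_{ij} : i>k,\ j\le k\}$. **Proposition.** For all $0\le k\le n$ there is a split short exact sequence \[ 1\longrightarrow \mathcal J_n(k)\longrightarrow \mathrm{P\Pi A}_n(k)\stackrel{\theta_*}{\longrightarrow} \mathrm{P\Pi A}_{n-k}\longrightarrow 1, \] in which the first map is the inclusion and $\theta_*$ is induced by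 the homomorphism $\theta:F_n\to F_{n-k}$ that sends $x_1,\dots,x_k$ to $1$ and $x_{k+1},\dots,x_n$ to the basis elements of $F_{n-k}$ in order; that is, $\theta_*(\alpha)(\theta(w))=\theta(\alpha(w))$ for all $\alpha\in \mathrm{P\Pi A}_n(k)$ and $w\in F_n$. Here "split" means that $\theta_*$ has a section that is a group homomorphism. -/

import Mathlib

namespace Palindromic

/-- The endomorphism of the free group `F_n` on `x_0, …, x_{n-1}` that sends `x_i` to `w`
and fixes every other basis element. -/
def replaceHom {n : ℕ} (i : Fin n) (w : FreeGroup (Fin n)) :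
    FreeGroup (Fin n) →* FreeGroup (Fin n) :=
  FreeGroup.lift (Function.update FreeGroup.of i w)

theorem replaceHom_of_self {n : ℕ} (i : Fin n) (w : FreeGroup (Fin n)) :
    replaceHom i w (FreeGroup.of i) = w := by
  simp [replaceHom]

theorem replaceHom_of_ne {n : ℕ} {i l : Fin n} (h : l ≠ i) (w : FreeGroup (Fin n)) :
    replaceHom i w (FreeGroup.of l) = FreeGroup.of l := by
  simp [replaceHom, h]

/-- The elementary palindromic automorphism `P_ij` (for `i ≠ j`): it sends `x_i` to
`x_j x_i x_j` and fixes every other basis element. -/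
def elementary {n : ℕ} (i j : Fin n) (h : i ≠ j) : MulAut (FreeGroup (Fin n)) :=
  MonoidHom.toMulEquiv
    (replaceHom i (FreeGroup.of j * FreeGroup.of i * FreeGroup.of j))
    (replaceHom i ((FreeGroup.of j)⁻¹ * FreeGroup.of i * (FreeGroup.of j)⁻¹))
    (by
      refine FreeGroup.ext_hom _ _ fun l => ?_
      by_cases hl : l = i
      · subst hl
        simp [replaceHom_of_self, replaceHom_of_ne h.symm, mul_assoc]
      · simp [replaceHom_of_ne hl])
    (by
      refine FreeGroup.ext_hom _ _ fun l => ?_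
      by_cases hl : l = i
      · subst hl
        simp [replaceHom_of_self, replaceHom_of_ne h.symm, mul_assoc]
      · simp [replaceHom_of_ne hl])

/-- The inversion `ι_i`: it sends `x_i` to `x_i⁻¹` and fixes every other basis element. -/
def inversion {n : ℕ} (i : Fin n) : MulAut (FreeGroup (Fin n)) :=
  MonoidHom.toMulEquiv (replaceHom i (FreeGroup.of i)⁻¹) (replaceHom i (FreeGroup.of i)⁻¹)
    (by
      refine FreeGroup.ext_hom _ _ fun l => ?_
      by_cases hl : l = i
      · subst hl
        simp [replaceHom_of_self]
      · simp [replaceHom_of_ne hl])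
    (by
      refine FreeGroup.ext_hom _ _ fun l => ?_
      by_cases hl : l = i
      · subst hl
        simp [replaceHom_of_self]
      · simp [replaceHom_of_ne hl])

/-- The pure palindromic automorphism group `PΠA_n`, generated in `Aut(F_n)` by all elementary
palindromic automorphisms and all inversions. -/
def purePal (n : ℕ) : Subgroup (MulAut (FreeGroup (Fin n))) :=
  Subgroup.closure
    ({α | ∃ (i j : Fin n) (h : i ≠ j), α = elementary i j h} ∪ {α | ∃ i : Fin n, α = inversion i})

/-- The subgroup `PΠA_n(k)` of `PΠA_n` of those automorphisms that fix the first `k` basis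
elements (those with index `< k`, as indices start from `0`). -/
def pureFix (n k : ℕ) : Subgroup (MulAut (FreeGroup (Fin n))) where
  carrier := {α | α ∈ purePal n ∧
    ∀ i : Fin n, (i : ℕ) < k → α (FreeGroup.of i) = FreeGroup.of i}
  one_mem' := ⟨one_mem _, fun _ _ => rfl⟩
  mul_mem' := fun {α β} ha hb => ⟨mul_mem ha.1 hb.1, fun i hi => by
    rw [MulAut.mul_apply, hb.2 i hi, ha.2 i hi]⟩
  inv_mem' := fun {α} ha => ⟨inv_mem ha.1, fun i hi => by
    rw [MulAut.inv_apply, MulEquiv.symm_apply_eq, ha.2 i hi]⟩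

/-- The group `J_n(k)`: the normal closure in `PΠA_n(k)` of the `P_ij` for which `x_i` is not,
and `x_j` is, among the first `k` basis elements. -/
def birmanKernel (n k : ℕ) : Subgroup (pureFix n k) :=
  Subgroup.normalClosure
    {α | ∃ (i j : Fin n) (h : i ≠ j), k ≤ (i : ℕ) ∧ (j : ℕ) < k ∧
      (α : MulAut (FreeGroup (Fin n))) = elementary i j h}

/-- The homomorphism `F_n → F_{n-k}` that kills the first `k` basis elements and sends the
remaining ones, in order, to the basis of `F_{n-k}`. -/
def kill (n k : ℕ) : FreeGroup (Fin n) →* FreeGroup (Fin (n - k)) :=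
  FreeGroup.lift fun i : Fin n =>
    if h : k ≤ (i : ℕ) then FreeGroup.of ⟨(i : ℕ) - k, by omega⟩ else 1

end Palindromic

/-! The section extends an automorphism of `F_{n-k}` by the identity on the first `k` basis
elements. Each `P_ij` or `ι_i` that moves an `x_i` outside the first `k` lies in `J_n(k)` or in the
image of the section. Once these elements are known to generate `PΠA_n(k)`, every `α` is an element
of `J_n(k)` times an extended automorphism; as `J_n(k)` dies under `θ_*`, it is the whole kernel.

Generation (`mem_closure_fixGenerators`) is a Nielsen reduction. A pure palindromic `α` sends each
`x_i` to a reduced odd palindrome with middle letter `x_i^{±1}`. Compare the left halves, middle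
letter included, of the images of all signed letters. If they form a prefix code, cancellation in a
product never reaches a middle letter (`exists_reduced_product`), and surjectivity forces `α(x_i) =
x_i^{±1}` for all `i`. Otherwise one left half begins another, and multiplying the longer palindrome
on both sides by the inverse of the shorter one shortens it (`norm_lt_of_leftHalf_prefix`). This
amounts to composing `α` with some `P_ij^{±1}`, so induction on the total length of the images
applies. An image of length 1 cannot be shortened this way, so the first `k` basis elements stay
fixed throughout. -/

namespace Palindromic

open FreeGroup hiding map_mul map_inv map_one

/-! ### Odd palindromes and cancellation between them. -/

section Words

variable {X : Type*}

/-- The inverse of a letter. -/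
def invLetter (a : X × Bool) : X × Bool := (a.1, !a.2)

@[simp]
theorem invLetter_invLetter (a : X × Bool) : invLetter (invLetter a) = a := by
  simp [invLetter]

theorem invLetter_ne (a : X × Bool) : invLetter a ≠ a := fun h => by
  simpa [invLetter] using congrArg Prod.snd h

theorem invRev_eq (l : List (X × Bool)) : invRev l = (l.map invLetter).reverse := rfl

/-- The palindrome of odd length with middle letter `a` and right half `u`. -/
def oddPal (u : List (X × Bool)) (a : X × Bool) : List (X × Bool) := u.reverse ++ a :: u

/-- The left half of `oddPal u a` including the middle letter. -/
def leftHalf (u : List (X × Bool)) (a : X × Bool) : List (X × Bool) := u.reverse ++ [a]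

theorem oddPal_eq (u : List (X × Bool)) (a : X × Bool) : oddPal u a = leftHalf u a ++ u := by
  simp [oddPal, leftHalf]

theorem length_oddPal (u : List (X × Bool)) (a : X × Bool) :
    (oddPal u a).length = 2 * u.length + 1 := by
  simp [oddPal]; omega

theorem invRev_oddPal (u : List (X × Bool)) (a : X × Bool) :
    invRev (oddPal u a) = oddPal (u.map invLetter) (invLetter a) := by
  simp [invRev_eq, oddPal]

theorem isReduced_reverse {l : List (X × Bool)} : IsReduced l.reverse ↔ IsReduced l := by
  unfold FreeGroup.IsReduced
  rw [List.isChain_reverse]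
  refine ⟨fun h => h.imp fun a b hab e => (hab e.symm).symm,
    fun h => h.imp fun a b hab e => (hab e.symm).symm⟩

theorem isReduced_map_invLetter {l : List (X × Bool)} (h : IsReduced l) :
    IsReduced (l.map invLetter) := by
  unfold FreeGroup.IsReduced at *
  rw [List.isChain_map]
  exact h.imp fun a b hab e => by simpa [invLetter] using hab e

theorem isReduced_invRev {l : List (X × Bool)} (h : IsReduced l) : IsReduced (invRev l) :=
  isReduced_reverse.2 (isReduced_map_invLetter h)

theorem isReduced_oddPal {u : List (X × Bool)} {a : X × Bool} (h : IsReduced (a :: u)) :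
    IsReduced (oddPal u a) := by
  have h' : IsReduced (u.reverse ++ [a]) := by
    rw [← List.reverse_cons]; exact isReduced_reverse.2 h
  exact List.isChain_split.2 ⟨h', h⟩

/-- A product of reduced words is reduced once the common prefix has been cancelled. -/
theorem isReduced_invRev_append {d d' : X × Bool} {l l' : List (X × Bool)}
    (h : IsReduced (d :: l)) (h' : IsReduced (d' :: l')) (hd : d ≠ d') :
    IsReduced (invRev (d :: l) ++ d' :: l') := by
  refine List.IsChain.append (isReduced_invRev h) h' fun x hx y hy hxy => ?_
  simp only [invRev_eq, List.map_cons, List.reverse_cons, List.getLast?_append,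
    List.getLast?_singleton, List.head?_cons, Option.mem_def, Option.some_or,
    Option.some.injEq] at hx hy
  subst hx hy
  simp only [invLetter] at *
  by_contra hne
  exact hd (Prod.ext hxy (by simpa using hne))

theorem exists_reduced_oddPal (i : X) (u : List (X × Bool)) (hu : IsReduced u) (e : Bool) :
    ∃ v e', IsReduced ((i, e') :: v) ∧ mk (oddPal u (i, e)) = mk (oddPal v (i, e')) := by
  induction u generalizing e with
  | nil => exact ⟨[], e, List.isChain_singleton _, rfl⟩
  | cons a u ih =>
    by_cases ha : a = invLetter (i, e)
    -- The letters on both sides of the middle cancel it: `x⁻¹ x x⁻¹ = x⁻¹`, a shorter palindrome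
    -- with inverted middle letter.
    · obtain ⟨v, e', hv, h⟩ := ih hu.tail (!e)
      refine ⟨v, e', hv, ?_⟩
      rw [← h, ha]
      have hc : mk [(i, !e)] * mk [(i, e)] = 1 := by
        have : mk [(i, !e)] = (mk [(i, e)])⁻¹ := by simp [inv_mk, invRev_eq, invLetter]
        rw [this, inv_mul_cancel]
      have h1 : oddPal (invLetter (i, e) :: u) (i, e) =
          u.reverse ++ ([(i, !e)] ++ ([(i, e)] ++ ([(i, !e)] ++ u))) := by
        simp [oddPal, invLetter]
      have h2 : oddPal u (i, !e) = u.reverse ++ ([(i, !e)] ++ u) := by simp [oddPal]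
      rw [h1, h2]
      simp only [← mul_mk]
      rw [← mul_assoc (mk [(i, !e)]) (mk [(i, e)]), hc, one_mul]
    · refine ⟨a :: u, e, List.isChain_cons_cons.2 ⟨fun h1 => ?_, hu⟩, rfl⟩
      by_contra h2
      refine ha (Prod.ext h1.symm ?_)
      simp only [invLetter] at *
      revert h2
      cases e <;> cases a.2 <;> simp

theorem exists_split_of_not_prefix {A : Type*} (l m : List A) (h1 : ¬ l <+: m) (h2 : ¬ m <+: l) :
    ∃ c d d' f f', d ≠ d' ∧ l = c ++ d :: f ∧ m = c ++ d' :: f' := by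
  induction l generalizing m with
  | nil => exact absurd (List.nil_prefix) h1
  | cons a l ih =>
    cases m with
    | nil => exact absurd (List.nil_prefix) h2
    | cons b m =>
      by_cases hab : a = b
      · subst hab
        obtain ⟨c, d, d', f, f', hd, hl, hm⟩ := ih m
          (fun h => h1 (List.cons_prefix_cons.2 ⟨rfl, h⟩))
          (fun h => h2 (List.cons_prefix_cons.2 ⟨rfl, h⟩))
        exact ⟨a :: c, d, d', f, f', hd, by simp [hl], by simp [hm]⟩
      · exact ⟨[], a, b, l, m, hab, rfl, rfl⟩

theorem norm_mk_of_isReduced [DecidableEq X] {l : List (X × Bool)} (h : IsReduced l) :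
    (mk l).norm = l.length := by
  rw [FreeGroup.norm, toWord_mk, h.reduce_eq]

/-- If the left half of one odd palindrome is a prefix of the left half of a longer one, then the
longer one can be shortened. -/
theorem norm_lt_of_leftHalf_prefix [DecidableEq X] {u v : List (X × Bool)} {a b : X × Bool}
    (hv : IsReduced (b :: v)) (h : leftHalf u a <+: v.reverse) :
    ((mk (oddPal u a))⁻¹ * mk (oddPal v b) * (mk (oddPal u a))⁻¹).norm <
      (mk (oddPal v b)).norm := by
  obtain ⟨z, hz⟩ := h
  obtain rfl : v = z.reverse ++ a :: u := by
    have := congrArg List.reverse hz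
    simpa [leftHalf] using this.symm
  rw [norm_mk_of_isReduced (isReduced_oddPal hv)]
  have h1 : mk (oddPal (z.reverse ++ a :: u) b) =
      mk (leftHalf u a) * mk (oddPal z.reverse b) * mk (a :: u) := by
    simp [oddPal, leftHalf, mul_mk]
  have h2 : mk (oddPal u a) = mk (leftHalf u a) * mk u := by rw [mul_mk, oddPal_eq]
  have h3 : mk (oddPal u a) = mk u.reverse * mk (a :: u) := by rw [mul_mk, oddPal]
  -- The left factor cancels the prefix `leftHalf u a`, the right one the suffix `a :: u`. Each side
  -- loses `|u| + 1` letters and gains at most `|u|`.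
  have h4 : (mk (oddPal u a))⁻¹ * mk (oddPal (z.reverse ++ a :: u) b) * (mk (oddPal u a))⁻¹ =
      mk (invRev u ++ oddPal z.reverse b ++ invRev u.reverse) := by
    rw [← mul_mk, ← mul_mk, ← inv_mk, ← inv_mk, h1]
    nth_rw 1 [h2]
    rw [h3]
    group
  rw [h4]
  refine norm_mk_le.trans_lt ?_
  simp [length_oddPal, invRev_length]
  omega

/-- If the left halves of a family of odd palindromes, indexed by signed letters compatibly with
inversion, form a prefix code, then in the product along a reduced word the left half of the first
factor survives, and so does a letter of each further factor. -/
theorem exists_reduced_product {U : X × Bool → List (X × Bool)} {C : X × Bool → X × Bool}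
    (hred : ∀ s, IsReduced (C s :: U s)) (hU : ∀ s, U (invLetter s) = (U s).map invLetter)
    (hC : ∀ s, C (invLetter s) = invLetter (C s))
    (hcode : ∀ s t, leftHalf (U s) (C s) <+: leftHalf (U t) (C t) → s = t)
    (s : X × Bool) (L : List (X × Bool)) (hL : IsReduced (s :: L)) :
    ∃ t, IsReduced (leftHalf (U s) (C s) ++ t) ∧ L.length ≤ t.length ∧
      mk ((s :: L).flatMap fun r => oddPal (U r) (C r)) = mk (leftHalf (U s) (C s) ++ t) := by
  induction L generalizing s with
  | nil =>
    refine ⟨U s, ?_, by simp, by simp [oddPal_eq]⟩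
    rw [← oddPal_eq]
    exact isReduced_oddPal (hred s)
  | cons b L ih =>
    obtain ⟨hsb, hL⟩ := List.isChain_cons_cons.1 hL
    obtain ⟨t, ht, hlen, hmk⟩ := ih b hL
    have hne : invLetter s ≠ b := by
      rintro rfl
      simp [invLetter] at hsb
    -- The factor of `s` is the inverse of the factor of `s⁻¹`, so what cancels against the factor
    -- of `b` is the common prefix `c` of the two left halves.
    obtain ⟨c, d, d', f, f', hd, h1, h2⟩ := exists_split_of_not_prefix
      (leftHalf (U (invLetter s)) (C (invLetter s))) (leftHalf (U b) (C b))
      (fun h => hne (hcode _ _ h)) (fun h => hne (hcode _ _ h).symm)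
    -- The middle letter ends the left half, hence lies beyond `c` and survives; `d'` is the
    -- surviving letter counted for `b`.
    obtain ⟨g, hg⟩ : ∃ g, d :: f = g ++ [C (invLetter s)] := by
      have := congrArg List.getLast? h1
      simp only [leftHalf, List.getLast?_append, List.getLast?_singleton, Option.some_or] at this
      rcases List.eq_nil_or_concat (d :: f) with h | ⟨g, y, h⟩
      · simp at h
      · refine ⟨g, ?_⟩
        rw [h] at this ⊢
        simpa using this.symm
    have hred1 : IsReduced (d :: (f ++ U (invLetter s))) := by
      have := isReduced_oddPal (hred (invLetter s))
      rw [oddPal_eq, h1, List.append_assoc] at this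
      exact this.right_of_append
    have hred2 : IsReduced (d' :: (f' ++ t)) := by
      rw [h2, List.append_assoc] at ht
      exact ht.right_of_append
    have hs : invRev (d :: (f ++ U (invLetter s))) = leftHalf (U s) (C s) ++ invRev g := by
      rw [← List.cons_append, hg]
      simp [invRev_eq, leftHalf, hU, hC, Function.comp_def]
    refine ⟨invRev g ++ d' :: (f' ++ t), ?_, ?_, ?_⟩
    · rw [← List.append_assoc, ← hs]
      exact isReduced_invRev_append hred1 hred2 hd
    · simp; omega
    · rw [List.flatMap_cons, ← mul_mk, hmk, ← List.append_assoc, ← hs, h2]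
      have h3 : oddPal (U s) (C s) = invRev (c ++ d :: (f ++ U (invLetter s))) := by
        rw [← List.cons_append, ← List.append_assoc, ← h1, ← oddPal_eq, invRev_oddPal, hU, hC]
        simp [Function.comp_def]
      simp only [h3, List.append_assoc, List.cons_append, ← mul_mk, ← inv_mk]
      group

end Words

/-! ### Palindromic images of basis elements and the shortening dichotomy. -/

section Automorphisms

variable {X : Type*}

/-- The involution of a free group that inverts every basis element. -/
def bar : FreeGroup X →* FreeGroup X := FreeGroup.lift fun i => (of i)⁻¹

@[simp]
theorem bar_of (i : X) : bar (of i) = (of i)⁻¹ := by simp [bar]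

@[simp]
theorem bar_bar (w : FreeGroup X) : bar (bar w) = w := by
  have : (bar.comp bar : FreeGroup X →* FreeGroup X) = MonoidHom.id _ := by ext; simp
  exact DFunLike.congr_fun this w

theorem mk_singleton_invLetter (a : X × Bool) : mk [invLetter a] = (mk [a])⁻¹ := by
  simp [inv_mk, invRev_eq]

theorem bar_mk_singleton (a : X × Bool) : bar (mk [a]) = mk [invLetter a] := by
  rw [mk_singleton_invLetter]
  obtain ⟨i, e⟩ := a
  cases e
  · rw [show mk [(i, false)] = (of i)⁻¹ from rfl]; simp
  · exact bar_of i

/-- Makes `(bar w)⁻¹ * x * w` the group-theoretic form of an odd palindrome. -/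
theorem inv_bar_mk (u : List (X × Bool)) : (bar (mk u))⁻¹ = mk u.reverse := by
  induction u with
  | nil => simp [← one_eq_mk]
  | cons a u ih =>
    rw [← List.singleton_append, ← mul_mk, map_mul, mul_inv_rev, ih, bar_mk_singleton,
      mk_singleton_invLetter, inv_inv, mul_mk]
    simp

/-- The automorphism commutes with `bar` and sends every basis element `x_i` to an odd palindrome
with middle letter `x_i` or its inverse. -/
structure IsPurePal (α : MulAut (FreeGroup X)) : Prop where intro ::
  map_bar : ∀ w, α (bar w) = bar (α w)
  map_of : ∀ i, ∃ w e, α (of i) = (bar w)⁻¹ * mk [(i, e)] * w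

/-- `bar` inverts every element `(bar w)⁻¹ * x * w` with `x` a letter, so `α ∘ bar` and `bar ∘ α`
agree on the basis. -/
theorem IsPurePal.of_basis {α : MulAut (FreeGroup X)}
    (h : ∀ i, ∃ w e, α (of i) = (bar w)⁻¹ * mk [(i, e)] * w) : IsPurePal α where
  map_bar := by
    have : α.toMonoidHom.comp bar = bar.comp α.toMonoidHom := by
      ext i
      obtain ⟨w, e, hw⟩ := h i
      simp [hw, bar_mk_singleton, mk_singleton_invLetter, mul_assoc]
    exact DFunLike.congr_fun this
  map_of := h

theorem IsPurePal.map_letter {α : MulAut (FreeGroup X)} (h : IsPurePal α) (a : X × Bool) :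
    ∃ w e, α (mk [a]) = (bar w)⁻¹ * mk [(a.1, e)] * w := by
  obtain ⟨i, e⟩ := a
  obtain ⟨w, e', hw⟩ := h.map_of i
  cases e
  · refine ⟨bar w, !e', ?_⟩
    rw [show mk [(i, false)] = (of i)⁻¹ from rfl, map_inv, hw,
      show (i, !e') = invLetter (i, e') from rfl, mk_singleton_invLetter]
    simp [mul_assoc]
  · exact ⟨w, e', hw⟩

theorem IsPurePal.mul {α β : MulAut (FreeGroup X)} (hα : IsPurePal α) (hβ : IsPurePal β) :
    IsPurePal (α * β) := by
  refine .of_basis fun i => ?_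
  obtain ⟨w, e, hw⟩ := hβ.map_of i
  obtain ⟨v, e', hv⟩ := hα.map_letter (i, e)
  refine ⟨v * α w, e', ?_⟩
  rw [MulAut.mul_apply, hw, map_mul, map_mul, hv, map_inv, hα.map_bar]
  simp [mul_assoc]

theorem IsPurePal.inv {α : MulAut (FreeGroup X)} (hα : IsPurePal α) : IsPurePal α⁻¹ := by
  have hbar : ∀ w, α⁻¹ (bar w) = bar (α⁻¹ w) := fun w => by
    apply α.injective
    rw [hα.map_bar, MulAut.apply_inv_self, MulAut.apply_inv_self]
  refine .of_basis fun i => ?_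
  obtain ⟨w, e, hw⟩ := hα.map_of i
  have h1 : α⁻¹ (mk [(i, e)]) = bar (α⁻¹ w) * of i * (α⁻¹ w)⁻¹ := by
    have h2 : mk [(i, e)] = bar w * α (of i) * w⁻¹ := by rw [hw]; group
    rw [h2, map_mul, map_mul, MulAut.inv_apply_self, hbar, map_inv]
  cases e
  · refine ⟨(bar (α⁻¹ w))⁻¹, false, ?_⟩
    rw [show mk [(i, false)] = (of i)⁻¹ from rfl] at h1 ⊢
    rw [map_inv, inv_eq_iff_eq_inv] at h1
    rw [h1]
    simp [mul_assoc]
  · refine ⟨(α⁻¹ w)⁻¹, true, ?_⟩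
    rw [show mk [(i, true)] = of i from rfl] at h1 ⊢
    rw [h1]
    simp

theorem IsPurePal.one : IsPurePal (1 : MulAut (FreeGroup X)) :=
  .of_basis fun i => ⟨1, true, by rw [show mk [(i, true)] = of i from rfl]; simp⟩

theorem exists_reduced_oddPal_eq {i : X} {g : FreeGroup X}
    (h : ∃ w e, g = (bar w)⁻¹ * mk [(i, e)] * w) :
    ∃ v e, IsReduced ((i, e) :: v) ∧ g = mk (oddPal v (i, e)) := by
  classical
  obtain ⟨w, e, rfl⟩ := h
  obtain ⟨v, e', hv, hmk⟩ := exists_reduced_oddPal i w.toWord isReduced_toWord e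
  refine ⟨v, e', hv, ?_⟩
  rw [← hmk, oddPal, ← mul_mk, ← inv_bar_mk, mk_toWord,
    ← List.singleton_append (l := w.toWord), ← mul_mk, mk_toWord, mul_assoc]

theorem map_mk_eq_flatMap {Y : Type*} (α : FreeGroup X →* FreeGroup Y)
    (P : X × Bool → List (Y × Bool)) (h : ∀ s, α (mk [s]) = mk (P s)) (L : List (X × Bool)) :
    α (mk L) = mk (L.flatMap P) := by
  induction L with
  | nil => simp [← one_eq_mk]
  | cons s L ih => rw [← List.singleton_append, ← mul_mk, map_mul, ih, h]; simp [mul_mk]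

variable [DecidableEq X]

/-- Either the automorphism only inverts some basis elements, or the image of some basis element
can be shortened by multiplying it on both sides by the image of another signed letter. -/
theorem IsPurePal.map_of_eq_or_exists_shorter {α : MulAut (FreeGroup X)} (h : IsPurePal α) :
    (∀ i, α (of i) = of i ∨ α (of i) = (of i)⁻¹) ∨
      ∃ i j e, i ≠ j ∧
        (α (mk [(j, e)]) * α (of i) * α (mk [(j, e)])).norm < (α (of i)).norm := by
  choose u c hred hα using fun i => exists_reduced_oddPal_eq (h.map_of i)
  let U : X × Bool → List (X × Bool) := fun s => if s.2 then u s.1 else (u s.1).map invLetter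
  let C : X × Bool → X × Bool := fun s => (s.1, if s.2 then c s.1 else !c s.1)
  have hU : ∀ s, U (invLetter s) = (U s).map invLetter := by
    rintro ⟨i, _ | _⟩ <;> simp [U, invLetter, Function.comp_def]
  have hC : ∀ s, C (invLetter s) = invLetter (C s) := by
    rintro ⟨i, _ | _⟩ <;> simp [C, invLetter]
  have hC1 : ∀ s, (C s).1 = s.1 := fun s => rfl
  have hUC : ∀ s, IsReduced (C s :: U s) := by
    rintro ⟨i, _ | _⟩
    · simpa [U, C, invLetter] using isReduced_map_invLetter (hred i)
    · simpa [U, C] using hred i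
  have hP : ∀ s, α (mk [s]) = mk (oddPal (U s) (C s)) := by
    rintro ⟨i, _ | _⟩
    · rw [show mk [(i, false)] = (of i)⁻¹ from rfl, map_inv, hα, inv_mk, invRev_oddPal]
      simp [U, C, invLetter]
    · exact (hα i).trans (by simp [U, C])
  by_cases hcode : ∀ s t, leftHalf (U s) (C s) <+: leftHalf (U t) (C t) → s = t
  · left
    intro i
    obtain ⟨w, hw⟩ := α.surjective (of i)
    have hne : w.toWord ≠ [] := by
      intro h0
      rw [toWord_eq_nil_iff.1 h0, map_one] at hw
      exact one_ne_of i hw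
    obtain ⟨s, L, hL⟩ := List.exists_cons_of_ne_nil hne
    obtain ⟨t, ht, hlen, hmk⟩ := exists_reduced_product hUC hU hC hcode s L
      (hL ▸ isReduced_toWord)
    rw [← hL, ← map_mk_eq_flatMap α.toMonoidHom _ hP, mk_toWord] at hmk
    -- A reduced word of length 1 leaves room only for the middle letter, so the image of the letter
    -- `s` is `x_i` itself.
    have h1 : [(i, true)] = leftHalf (U s) (C s) ++ t := by
      rw [← ht.reduce_eq, ← toWord_mk, ← hmk, ← toWord_of]
      exact congrArg toWord hw.symm
    have h2 := congrArg List.length h1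
    simp only [leftHalf, List.length_append, List.length_reverse, List.length_singleton] at h2
    have hU0 : U s = [] := List.length_eq_zero_iff.1 (by omega)
    have ht0 : t = [] := List.length_eq_zero_iff.1 (by omega)
    have hCs : C s = (i, true) := by simpa [leftHalf, hU0, ht0] using h1.symm
    have hs := hP s
    rw [hU0, hCs] at hs
    have hsi : s.1 = i := by rw [← hC1, hCs]
    obtain ⟨j, e⟩ := s
    obtain rfl : j = i := hsi
    cases e
    · right
      rw [eq_inv_iff_mul_eq_one, ← inv_eq_iff_mul_eq_one, ← map_inv]
      exact hs
    · exact .inl hs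
  · right
    push Not at hcode
    obtain ⟨s, t, hpre, hst⟩ := hcode
    have key : s.1 ≠ t.1 ∧ ((α (mk [s]))⁻¹ * α (mk [t]) * (α (mk [s]))⁻¹).norm <
        (α (mk [t])).norm := by
      have hlen : (U s).length ≤ (U t).length := by
        simpa [leftHalf] using hpre.length_le
      -- Equal lengths would give equal middle letters, hence `t = s⁻¹`, whose middle letter is the
      -- inverse one.
      have hne : (U s).length ≠ (U t).length := by
        intro heq
        have h1 : leftHalf (U s) (C s) = leftHalf (U t) (C t) :=
          hpre.eq_of_length (by simp [leftHalf, heq])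
        have h2 : C s = C t := by
          simpa using (List.append_inj' h1 rfl).2
        have h3 : s.1 = t.1 := by rw [← hC1, h2]
        have h4 : t = invLetter s := by
          refine Prod.ext h3.symm ?_
          have : s.2 ≠ t.2 := fun h => hst (Prod.ext h3 h)
          simp only [invLetter]
          revert this
          cases s.2 <;> cases t.2 <;> simp
        rw [h4, hC] at h2
        exact invLetter_ne _ h2.symm
      constructor
      · intro h3
        apply hne
        rcases Decidable.eq_or_ne s.2 t.2 with h | h
        · exact absurd (Prod.ext h3 h) hst
        · have hl : ∀ r : X × Bool, (U r).length = (u r.1).length := by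
            rintro ⟨i, _ | _⟩ <;> simp [U]
          rw [hl, hl, h3]
      · rw [hP, hP]
        refine norm_lt_of_leftHalf_prefix (hUC t) ?_
        refine List.prefix_of_prefix_length_le hpre (List.prefix_append _ _) ?_
        simp [leftHalf]; omega
    obtain ⟨hst1, hlt⟩ := key
    obtain ⟨i, _ | _⟩ := t
    · refine ⟨i, s.1, s.2, hst1.symm, ?_⟩
      rw [show mk [(i, false)] = (of i)⁻¹ from rfl, map_inv, norm_inv_eq, ← norm_inv_eq] at hlt
      simpa [mul_assoc] using hlt
    · refine ⟨i, s.1, !s.2, hst1.symm, ?_⟩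
      rw [show (s.1, !s.2) = invLetter s from rfl, mk_singleton_invLetter, map_inv]
      exact hlt

end Automorphisms

/-! ### Generators of the stabilizer `PΠA_n(k)`. -/

section Generators

variable {n : ℕ}

@[simp]
theorem elementary_of_self {i j : Fin n} (h : i ≠ j) :
    elementary i j h (of i) = of j * of i * of j :=
  replaceHom_of_self _ _

theorem elementary_of_ne {i j l : Fin n} (h : i ≠ j) (hl : l ≠ i) :
    elementary i j h (of l) = of l :=
  replaceHom_of_ne hl _

theorem elementary_inv_of_self {i j : Fin n} (h : i ≠ j) :
    (elementary i j h)⁻¹ (of i) = (of j)⁻¹ * of i * (of j)⁻¹ :=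
  replaceHom_of_self _ _

theorem elementary_inv_of_ne {i j l : Fin n} (h : i ≠ j) (hl : l ≠ i) :
    (elementary i j h)⁻¹ (of l) = of l :=
  replaceHom_of_ne hl _

@[simp]
theorem inversion_of_self (i : Fin n) : inversion i (of i) = (of i)⁻¹ :=
  replaceHom_of_self _ _

theorem inversion_of_ne {i l : Fin n} (hl : l ≠ i) : inversion i (of l) = of l :=
  replaceHom_of_ne hl _

theorem mulAut_ext {X : Type*} {α β : MulAut (FreeGroup X)} (h : ∀ i, α (of i) = β (of i)) :
    α = β := by
  have : α.toMonoidHom = β.toMonoidHom := FreeGroup.ext_hom _ _ h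
  exact MulEquiv.ext fun w => DFunLike.congr_fun this w

theorem isPurePal_of_mem_purePal {α : MulAut (FreeGroup (Fin n))} (h : α ∈ purePal n) :
    IsPurePal α := by
  induction h using Subgroup.closure_induction with
  | mem α hα =>
    refine .of_basis fun l => ?_
    have hl : of l = (bar 1)⁻¹ * mk [(l, true)] * 1 := by simp; rfl
    rcases hα with ⟨i, j, hij, rfl⟩ | ⟨i, rfl⟩
    · by_cases hli : l = i
      · subst hli
        refine ⟨of j, true, ?_⟩
        rw [elementary_of_self, bar_of, inv_inv]
        rfl
      · exact ⟨1, true, by rw [elementary_of_ne hij hli, ← hl]⟩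
    · by_cases hli : l = i
      · subst hli
        refine ⟨1, false, ?_⟩
        rw [inversion_of_self]
        simp
        rfl
      · exact ⟨1, true, by rw [inversion_of_ne hli, ← hl]⟩
  | one => exact .one
  | mul _ _ _ _ hα hβ => exact hα.mul hβ
  | inv _ _ hα => exact hα.inv

/-- The elementary palindromic automorphisms and the inversions that move none of the first `k`
basis elements. -/
def fixGenerators (n k : ℕ) : Set (MulAut (FreeGroup (Fin n))) :=
  {α | ∃ (i j : Fin n) (h : i ≠ j), k ≤ (i : ℕ) ∧ α = elementary i j h} ∪
    {α | ∃ i : Fin n, k ≤ (i : ℕ) ∧ α = inversion i}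

theorem elementary_mem_pureFix {k : ℕ} {i j : Fin n} (h : i ≠ j) (hi : k ≤ (i : ℕ)) :
    elementary i j h ∈ pureFix n k :=
  ⟨Subgroup.subset_closure (.inl ⟨i, j, h, rfl⟩),
    fun l hl => elementary_of_ne h (by rintro rfl; omega)⟩

theorem inversion_mem_pureFix {k : ℕ} {i : Fin n} (hi : k ≤ (i : ℕ)) :
    inversion i ∈ pureFix n k :=
  ⟨Subgroup.subset_closure (.inr ⟨i, rfl⟩),
    fun l hl => inversion_of_ne (by rintro rfl; omega)⟩

/-- The base of the reduction: `s` bounds the set of inverted basis elements, and composing with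
`inversion a` removes `a` from it. -/
theorem mem_closure_fixGenerators_of_inversions {k : ℕ} (s : Finset (Fin n))
    {α : MulAut (FreeGroup (Fin n))} (hs : ∀ i ∉ s, α (of i) = of i)
    (hk : ∀ i : Fin n, (i : ℕ) < k → α (of i) = of i)
    (hα : ∀ i, α (of i) = of i ∨ α (of i) = (of i)⁻¹) :
    α ∈ Subgroup.closure (fixGenerators n k) := by
  induction s using Finset.induction_on generalizing α with
  | empty =>
    rw [show α = 1 from mulAut_ext fun i => by simp [hs i]]
    exact one_mem _
  | insert a s ha ih =>
    by_cases hfix : α (of a) = of a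
    · refine ih (fun i hi => ?_) hk hα
      by_cases hia : i = a
      · rw [hia, hfix]
      · exact hs i (by simp [hia, hi])
    · have hka : k ≤ (a : ℕ) := by
        by_contra hlt
        exact hfix (hk a (by omega))
      have hinv := (hα a).resolve_left hfix
      have hval : ∀ i, (α * inversion a) (of i) = if i = a then of i else α (of i) := fun i => by
        split_ifs with h
        · rw [h, MulAut.mul_apply, inversion_of_self, map_inv, hinv, inv_inv]
        · rw [MulAut.mul_apply, inversion_of_ne h]
      have hmem : α * inversion a ∈ Subgroup.closure (fixGenerators n k) := by
        refine ih (fun i hi => ?_) (fun i hi => ?_) (fun i => ?_)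
        · rw [hval]
          split_ifs with h
          · rfl
          · exact hs i (by simp [h, hi])
        · rw [hval]
          split_ifs with h
          · rfl
          · exact hk i hi
        · rw [hval]
          split_ifs with h
          · exact .inl rfl
          · exact hα i
      exact (Subgroup.mul_mem_cancel_right _
        (Subgroup.subset_closure (.inr ⟨a, hka, rfl⟩))).1 hmem

/-- The stabilizer `PΠA_n(k)` is generated by the elementary palindromic automorphisms and the
inversions that it contains. -/
theorem mem_closure_fixGenerators {k : ℕ} {α : MulAut (FreeGroup (Fin n))}
    (h : α ∈ pureFix n k) : α ∈ Subgroup.closure (fixGenerators n k) := by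
  induction hN : ∑ i, (α (of i)).norm using Nat.strong_induction_on generalizing α with
  | _ N ih =>
    subst hN
    rcases (isPurePal_of_mem_purePal h.1).map_of_eq_or_exists_shorter with hα | ⟨i, j, e, hij, hlt⟩
    · exact mem_closure_fixGenerators_of_inversions Finset.univ (by simp) h.2 hα
    · have hne : mk [(j, e)] * of i * mk [(j, e)] ≠ 1 := by
        intro h1
        -- The exponent sum of `x_i` in this word is 1.
        have h2 := congrArg (FreeGroup.lift (Function.update (fun _ => 1) i
          (Multiplicative.ofAdd (1 : ℤ)))) h1
        cases e <;> simp [hij.symm] at h2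
      have hki : k ≤ (i : ℕ) := by
        by_contra hik
        rw [h.2 i (by omega), norm_of] at hlt
        have h1 := norm_eq_zero.1 (Nat.lt_one_iff.1 hlt)
        rw [← h.2 i (by omega), ← map_mul, ← map_mul] at h1
        exact hne ((map_eq_one_iff α α.injective).1 h1)
      -- `β` is `P_ij` or its inverse, according to the sign `e`; `α * β` has the shortened image at
      -- `x_i` and the old ones elsewhere.
      obtain ⟨β, hβ, hβi, hβl⟩ : ∃ β ∈ Subgroup.closure (fixGenerators n k) ⊓ pureFix n k,
          β (of i) = mk [(j, e)] * of i * mk [(j, e)] ∧ ∀ l ≠ i, β (of l) = of l := by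
        have hmem : elementary i j hij ∈ Subgroup.closure (fixGenerators n k) ⊓ pureFix n k :=
          ⟨Subgroup.subset_closure (.inl ⟨i, j, hij, hki, rfl⟩), elementary_mem_pureFix hij hki⟩
        cases e
        · exact ⟨_, inv_mem hmem, elementary_inv_of_self hij,
            fun l hl => elementary_inv_of_ne hij hl⟩
        · exact ⟨_, hmem, elementary_of_self hij, fun l hl => elementary_of_ne hij hl⟩
      refine (Subgroup.mul_mem_cancel_right _ hβ.1).1 (ih _ ?_ (mul_mem h hβ.2) rfl)
      refine Finset.sum_lt_sum (fun l _ => ?_) ⟨i, Finset.mem_univ _, ?_⟩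
      · by_cases hl : l = i
        · rw [hl, MulAut.mul_apply, hβi, map_mul, map_mul]
          exact hlt.le
        · rw [MulAut.mul_apply, hβl l hl]
      · rw [MulAut.mul_apply, hβi, map_mul, map_mul]
        exact hlt

end Generators

/-! ### The induced homomorphism, its section and its kernel. -/

section Extension

variable {n k : ℕ}

/-- The position in `F_n` of a basis element of `F_{n-k}`. -/
def shiftIndex (y : Fin (n - k)) : Fin n := ⟨y + k, by omega⟩

theorem le_shiftIndex (y : Fin (n - k)) : k ≤ (shiftIndex y : ℕ) := Nat.le_add_left _ _

theorem shiftIndex_injective : Function.Injective (shiftIndex : Fin (n - k) → Fin n) :=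
  fun a b h => Fin.ext (by simpa [shiftIndex] using congrArg Fin.val h)

theorem exists_shiftIndex_eq {i : Fin n} (h : k ≤ (i : ℕ)) :
    ∃ y : Fin (n - k), i = shiftIndex y :=
  ⟨⟨i - k, by omega⟩, Fin.ext (by simp [shiftIndex, h])⟩

/-- The inclusion of `F_{n-k}` in `F_n` as the free factor on the last basis elements. -/
def shift (n k : ℕ) : FreeGroup (Fin (n - k)) →* FreeGroup (Fin n) :=
  FreeGroup.map shiftIndex

@[simp]
theorem shift_of (y : Fin (n - k)) : shift n k (of y) = of (shiftIndex y) := by simp [shift]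

@[simp]
theorem kill_of_shiftIndex (y : Fin (n - k)) : kill n k (of (shiftIndex y)) = of y := by
  simp [kill, shiftIndex]

theorem kill_of_lt {i : Fin n} (h : (i : ℕ) < k) : kill n k (of i) = 1 := by
  simp [kill, h]

@[simp]
theorem kill_shift (w : FreeGroup (Fin (n - k))) : kill n k (shift n k w) = w := by
  have : (kill n k).comp (shift n k) = MonoidHom.id _ := by ext; simp
  exact DFunLike.congr_fun this w

/-- As `α` fixes the basis elements that `kill` kills, `kill ∘ α` factors through `kill`. This makes
the induced map well defined and multiplicative. -/
theorem kill_apply_shift_kill {α : MulAut (FreeGroup (Fin n))} (h : α ∈ pureFix n k)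
    (w : FreeGroup (Fin n)) : kill n k (α (shift n k (kill n k w))) = kill n k (α w) := by
  have : (((kill n k).comp α.toMonoidHom).comp (shift n k)).comp (kill n k) =
      (kill n k).comp α.toMonoidHom := by
    refine FreeGroup.ext_hom _ _ fun i => ?_
    rcases lt_or_ge (i : ℕ) k with hi | hi
    · simp [kill_of_lt hi, h.2 i hi]
    · obtain ⟨y, rfl⟩ := exists_shiftIndex_eq hi
      simp
  exact DFunLike.congr_fun this w

/-- The automorphism of `F_{n-k}` induced by an automorphism that fixes the first `k` basis
elements. -/
def induced (n k : ℕ) : pureFix n k →* MulAut (FreeGroup (Fin (n - k))) where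
  toFun α := MonoidHom.toMulEquiv
    (((kill n k).comp (α : MulAut (FreeGroup (Fin n))).toMonoidHom).comp (shift n k))
    (((kill n k).comp (α⁻¹ : MulAut (FreeGroup (Fin n))).toMonoidHom).comp (shift n k))
    (by ext y; exact (kill_apply_shift_kill (inv_mem α.2) _).trans (by simp))
    (by ext y; simp [kill_apply_shift_kill α.2])
  map_one' := by
    refine mulAut_ext fun y => ?_
    simp
  map_mul' α β := by
    refine mulAut_ext fun y => ?_
    simp [kill_apply_shift_kill α.2]

theorem induced_kill (α : pureFix n k) (w : FreeGroup (Fin n)) :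
    induced n k α (kill n k w) = kill n k ((α : MulAut (FreeGroup (Fin n))) w) :=
  kill_apply_shift_kill α.2 w

theorem induced_of (α : pureFix n k) (y : Fin (n - k)) :
    induced n k α (of y) = kill n k ((α : MulAut (FreeGroup (Fin n))) (of (shiftIndex y))) := by
  rw [← induced_kill, kill_of_shiftIndex]

/-- The extension of an endomorphism of `F_{n-k}` to `F_n` that fixes the first `k` basis
elements. -/
def extendHom (n k : ℕ) (f : FreeGroup (Fin (n - k)) →* FreeGroup (Fin (n - k))) :
    FreeGroup (Fin n) →* FreeGroup (Fin n) :=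
  FreeGroup.lift fun i => if k ≤ (i : ℕ) then shift n k (f (kill n k (of i))) else of i

theorem extendHom_of_lt (f : FreeGroup (Fin (n - k)) →* FreeGroup (Fin (n - k))) {i : Fin n}
    (h : (i : ℕ) < k) : extendHom n k f (of i) = of i := by
  simp [extendHom, h]

@[simp]
theorem extendHom_of_shiftIndex (f : FreeGroup (Fin (n - k)) →* FreeGroup (Fin (n - k)))
    (y : Fin (n - k)) : extendHom n k f (of (shiftIndex y)) = shift n k (f (of y)) := by
  simp [extendHom, le_shiftIndex]

theorem extendHom_shift (f : FreeGroup (Fin (n - k)) →* FreeGroup (Fin (n - k)))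
    (w : FreeGroup (Fin (n - k))) : extendHom n k f (shift n k w) = shift n k (f w) := by
  have : (extendHom n k f).comp (shift n k) = (shift n k).comp f := by ext; simp
  exact DFunLike.congr_fun this w

theorem extendHom_comp (f g : FreeGroup (Fin (n - k)) →* FreeGroup (Fin (n - k))) :
    extendHom n k (f.comp g) = (extendHom n k f).comp (extendHom n k g) := by
  refine FreeGroup.ext_hom _ _ fun i => ?_
  rcases lt_or_ge (i : ℕ) k with hi | hi
  · simp [extendHom_of_lt _ hi]
  · obtain ⟨y, rfl⟩ := exists_shiftIndex_eq hi
    simp [extendHom_shift]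

theorem extendHom_id : extendHom n k (MonoidHom.id _) = MonoidHom.id _ := by
  refine FreeGroup.ext_hom _ _ fun i => ?_
  rcases lt_or_ge (i : ℕ) k with hi | hi
  · simp [extendHom_of_lt _ hi]
  · obtain ⟨y, rfl⟩ := exists_shiftIndex_eq hi
    simp

/-- The extension of automorphisms of `F_{n-k}` to `F_n`. -/
def extendAut (n k : ℕ) : MulAut (FreeGroup (Fin (n - k))) →* MulAut (FreeGroup (Fin n)) where
  toFun β := MonoidHom.toMulEquiv (extendHom n k β.toMonoidHom)
    (extendHom n k (β⁻¹ : MulAut (FreeGroup (Fin (n - k)))).toMonoidHom)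
    (by
      rw [← extendHom_comp, ← extendHom_id]
      congr 1
      ext; simp)
    (by
      rw [← extendHom_comp, ← extendHom_id]
      congr 1
      ext; simp)
  map_one' := MulEquiv.ext fun w => DFunLike.congr_fun extendHom_id w
  map_mul' α β := MulEquiv.ext fun w =>
    DFunLike.congr_fun (extendHom_comp α.toMonoidHom β.toMonoidHom) w

theorem extendAut_of_lt (β : MulAut (FreeGroup (Fin (n - k)))) {i : Fin n} (h : (i : ℕ) < k) :
    extendAut n k β (of i) = of i :=
  extendHom_of_lt _ h

@[simp]
theorem extendAut_of_shiftIndex (β : MulAut (FreeGroup (Fin (n - k)))) (y : Fin (n - k)) :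
    extendAut n k β (of (shiftIndex y)) = shift n k (β (of y)) :=
  extendHom_of_shiftIndex _ y

theorem extendAut_elementary {i j : Fin (n - k)} (h : i ≠ j) :
    extendAut n k (elementary i j h) =
      elementary (shiftIndex i) (shiftIndex j) (shiftIndex_injective.ne h) := by
  refine mulAut_ext fun l => ?_
  rcases lt_or_ge (l : ℕ) k with hl | hl
  · have := le_shiftIndex i
    rw [extendAut_of_lt _ hl, elementary_of_ne _ (by rintro rfl; omega)]
  · obtain ⟨y, rfl⟩ := exists_shiftIndex_eq hl
    by_cases hy : y = i
    · subst hy; simp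
    · rw [extendAut_of_shiftIndex, elementary_of_ne _ hy, shift_of,
        elementary_of_ne _ (shiftIndex_injective.ne hy)]

theorem extendAut_inversion (i : Fin (n - k)) :
    extendAut n k (inversion i) = inversion (shiftIndex i) := by
  refine mulAut_ext fun l => ?_
  rcases lt_or_ge (l : ℕ) k with hl | hl
  · have := le_shiftIndex i
    rw [extendAut_of_lt _ hl, inversion_of_ne (by rintro rfl; omega)]
  · obtain ⟨y, rfl⟩ := exists_shiftIndex_eq hl
    by_cases hy : y = i
    · subst hy; simp
    · rw [extendAut_of_shiftIndex, inversion_of_ne hy, shift_of,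
        inversion_of_ne (shiftIndex_injective.ne hy)]

theorem extendAut_mem_pureFix {β : MulAut (FreeGroup (Fin (n - k)))} (h : β ∈ purePal (n - k)) :
    extendAut n k β ∈ pureFix n k := by
  suffices purePal (n - k) ≤ (pureFix n k).comap (extendAut n k) from this h
  refine (Subgroup.closure_le _).2 ?_
  rintro _ (⟨i, j, hij, rfl⟩ | ⟨i, rfl⟩)
  · rw [SetLike.mem_coe, Subgroup.mem_comap, extendAut_elementary]
    exact elementary_mem_pureFix _ (le_shiftIndex i)
  · rw [SetLike.mem_coe, Subgroup.mem_comap, extendAut_inversion]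
    exact inversion_mem_pureFix (le_shiftIndex i)

/-- The section of the induced homomorphism given by extension of automorphisms. -/
def extendPal (n k : ℕ) : purePal (n - k) →* pureFix n k :=
  ((extendAut n k).comp (purePal (n - k)).subtype).codRestrict _ fun β => extendAut_mem_pureFix β.2

theorem induced_extendPal (β : purePal (n - k)) : induced n k (extendPal n k β) = β := by
  refine mulAut_ext fun y => ?_
  rw [induced_of]
  exact (congrArg _ (extendAut_of_shiftIndex _ y)).trans (kill_shift _)

theorem birmanKernel_le_ker_induced : birmanKernel n k ≤ (induced n k).ker := by
  refine Subgroup.normalClosure_le_normal ?_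
  rintro α ⟨i, j, hij, hi, hj, hα⟩
  refine mulAut_ext fun y => ?_
  rw [induced_of, hα]
  by_cases hy : shiftIndex y = i
  · subst hy
    simp [kill_of_lt hj]
  · rw [elementary_of_ne _ hy]
    simp

/-- By generation it suffices to treat generators: `P_ij` with `j` among the first `k` indices lies
in the kernel, all others are extended from `F_{n-k}`. -/
theorem birmanKernel_sup_range_extendPal : birmanKernel n k ⊔ (extendPal n k).range = ⊤ := by
  refine eq_top_iff.2 fun α _ => ?_
  suffices Subgroup.closure (fixGenerators n k) ≤
      (birmanKernel n k ⊔ (extendPal n k).range).map (pureFix n k).subtype by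
    obtain ⟨β, hβ, h⟩ := this (mem_closure_fixGenerators α.2)
    rwa [← Subtype.ext h]
  refine (Subgroup.closure_le _).2 ?_
  rintro _ (⟨i, j, hij, hi, rfl⟩ | ⟨i, hi, rfl⟩)
  · refine ⟨⟨_, elementary_mem_pureFix hij hi⟩, ?_, rfl⟩
    rcases lt_or_ge (j : ℕ) k with hj | hj
    · exact Subgroup.mem_sup_left (Subgroup.subset_normalClosure ⟨i, j, hij, hi, hj, rfl⟩)
    · obtain ⟨y, rfl⟩ := exists_shiftIndex_eq hi
      obtain ⟨z, rfl⟩ := exists_shiftIndex_eq hj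
      have hyz : y ≠ z := fun h => hij (h ▸ rfl)
      exact Subgroup.mem_sup_right ⟨⟨_, Subgroup.subset_closure (.inl ⟨y, z, hyz, rfl⟩)⟩,
        Subtype.ext (extendAut_elementary hyz)⟩
  · refine ⟨⟨_, inversion_mem_pureFix hi⟩, ?_, rfl⟩
    obtain ⟨y, rfl⟩ := exists_shiftIndex_eq hi
    exact Subgroup.mem_sup_right ⟨⟨_, Subgroup.subset_closure (.inr ⟨y, rfl⟩)⟩,
      Subtype.ext (extendAut_inversion y)⟩

instance birmanKernel_normal : (birmanKernel n k).Normal := Subgroup.normalClosure_normal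

theorem exists_mul_extendPal (α : pureFix n k) :
    ∃ γ ∈ birmanKernel n k, ∃ β, α = γ * extendPal n k β := by
  have h : α ∈ birmanKernel n k ⊔ (extendPal n k).range := by
    rw [birmanKernel_sup_range_extendPal]; trivial
  obtain ⟨γ, hγ, _, ⟨β, rfl⟩, h⟩ := Subgroup.mem_sup_of_normal_left.1 h
  exact ⟨γ, hγ, β, h.symm⟩

theorem induced_mul_extendPal {γ : pureFix n k} (hγ : γ ∈ birmanKernel n k)
    (β : purePal (n - k)) : induced n k (γ * extendPal n k β) = β := by
  rw [map_mul, induced_extendPal, MonoidHom.mem_ker.1 (birmanKernel_le_ker_induced hγ), one_mul]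

/-- The factorization of `α` exhibits its induced automorphism as the factor `β`, which is pure
palindromic. -/
theorem induced_mem_purePal (α : pureFix n k) : induced n k α ∈ purePal (n - k) := by
  obtain ⟨γ, hγ, β, rfl⟩ := exists_mul_extendPal α
  rw [induced_mul_extendPal hγ]
  exact β.2

theorem ker_induced : (induced n k).ker = birmanKernel n k := by
  refine le_antisymm (fun α hα => ?_) birmanKernel_le_ker_induced
  obtain ⟨γ, hγ, β, rfl⟩ := exists_mul_extendPal α
  rw [MonoidHom.mem_ker, induced_mul_extendPal hγ] at hα
  rw [show β = 1 from Subtype.ext hα, map_one, mul_one]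
  exact hγ

/-- The Birman exact sequence of pure palindromic automorphism groups. -/
def birmanExtension (n k : ℕ) :
    GroupExtension (birmanKernel n k) (pureFix n k) (purePal (n - k)) where
  inl := (birmanKernel n k).subtype
  rightHom := (induced n k).codRestrict _ induced_mem_purePal
  inl_injective := Subtype.val_injective
  range_inl_eq_ker_rightHom := by
    rw [Subgroup.range_subtype, MonoidHom.ker_codRestrict, ker_induced]
  rightHom_surjective β := ⟨extendPal n k β, Subtype.ext (induced_extendPal β)⟩

end Extension

end Palindromic

theorem mainTheorem11 (n k : ℕ) (hk : k ≤ n) :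
    ∃ S : GroupExtension (Palindromic.birmanKernel n k) (Palindromic.pureFix n k)
        (Palindromic.purePal (n - k)),
      S.inl = (Palindromic.birmanKernel n k).subtype ∧
      (∀ (α : Palindromic.pureFix n k) (w : FreeGroup (Fin n)),
        (S.rightHom α : MulAut (FreeGroup (Fin (n - k)))) (Palindromic.kill n k w) =
          Palindromic.kill n k ((α : MulAut (FreeGroup (Fin n))) w)) ∧
      Nonempty S.Splitting :=
  ⟨Palindromic.birmanExtension n k, rfl, Palindromic.induced_kill,
    ⟨{ Palindromic.extendPal n k with
        rightInverse_rightHom := fun β => Subtype.ext (Palindromic.induced_extendPal β) }⟩⟩
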